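/- Let $F:[0,1]\to[0,1]$ be the Farey map, $F(x)=x/(1-x)$ for $0\le x\le 1/2$ and $F(x)=(1-x)/x$ for $1/2<x\le 1$, and let $\lambda$ be Lebesgue measure. Let $u\in(0,1)$ and, for integers $n\ge 1$, set $\mathscr{C}_n^u:=F^{-(n-1)}[u,1]=\{x\in[0,1]: F^{n-1}(x)\in[u,1]\}$, where $F^{n-1}$ is the $(n-1)$-fold iterate of $F$. Then: (a) the sequence $(\lambda(\mathscr{C}_n^u))_{n\ge1}$ is strictly decreasing; (b) as $n\to\infty$, $$\sum_{k=0}^n\lambda(\mathscr{C}_{k+1}^u)=\frac{n\log(1/u)}{\log n}\left(1+O_u\!\left(\frac{1}{\log n}\right)\right),$$ where the subscript $u$ means that the implied constant and the threshold on $n$ may depend on $u$. -/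

import Mathlib

/-- The Farey map `F`, given by `x / (1 - x)` for `x ≤ 1/2` and by `(1 - x) / x` for `1/2 < x`.
It is used only on `[0,1]`, which it maps into itself (`fareyMap_mapsTo`). -/
noncomputable def fareyMap (x : ℝ) : ℝ :=
  if x ≤ 1 / 2 then x / (1 - x) else (1 - x) / x

/-- The Farey map is a self-map of `[0,1]`. -/
theorem fareyMap_mapsTo : Set.MapsTo fareyMap (Set.Icc 0 1) (Set.Icc 0 1) := by
  rintro x ⟨h0, h1⟩
  unfold fareyMap
  split_ifs with h
  · exact ⟨div_nonneg h0 (by linarith), (div_le_one (by linarith)).2 (by linarith)⟩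
  · have h' : 1 / 2 < x := not_le.mp h
    exact ⟨div_nonneg (by linarith) h0, (div_le_one (by linarith)).2 (by linarith)⟩

/-- The set `C_n^u = F^{-(n-1)} [u,1]`, a subset of `[0,1]`, for `n ≥ 1`
(the truncated value at `n = 0` is not used). -/
def fareyLevelSet (u : ℝ) (n : ℕ) : Set ℝ :=
  {x | x ∈ Set.Icc (0 : ℝ) 1 ∧ fareyMap^[n - 1] x ∈ Set.Icc u 1}

/-!
The law of the `n`-th iterate of the Farey map under Lebesgue measure has density `φₙ(x) / x`, where
`dx / x` is the infinite invariant measure, `φ₀(x) = x` and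
`φₙ₊₁(x) = (φₙ(x / (1 + x)) + x φₙ(1 / (1 + x))) / (1 + x)`. Every `φₙ` is strictly increasing and
concave on `[0, 1]` (`fareyDensity_strictMonoOn_concaveOn`), and this drives both parts. Write
`Dₙ(u) = λ(Fⁿ ≥ u)`, the mass of `[u, 1]`.

The recursion for `Dₙ` shows that `Dₙ(u) - Dₙ₊₁(u)` is the mass of `[1 / (1 + u), 1]` minus that of
`[u / (1 + u), u]`. These intervals have the same `dx / x`-measure and the first lies further right,
so the difference is positive: this is strict decrease (`fareyTail_succ_lt`).

Put `cₙ = φₙ(1)`, so that `φₙ(1/2) = cₙ₊₁`. For `u ≤ 1/2` the same difference bounds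
`φₙ(1/2) - φₙ(u)` up to a factor depending on `u`; so the oscillation of `φₙ` on `[u, 1]` is bounded
by quantities that telescope when summed over `n` (`fareyDensity_one_sub_le`). Hence
`∑ Dₖ(u) = log (1 / u) ∑ cₖ + O_u(1)` (`sum_fareyTail_le`, `le_sum_fareyTail`).

To evaluate `∑ cₖ`, decompose orbits according to the last visit to `[1/2, 1]`: this gives the renewal equation `sum_fareyTail_eq_one_sub`, which together with
`cₖ₊₁ ≤ φₖ ≤ cₖ` on `[1/2, 1]` and summation over time yields
`∑_{k<n} cₖ₊₁ log (n - k + 1) ≤ n` and `n - log (n + 1) ≤ ∑_{k<n} cₖ log (n - k + 1)`.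
The second inequality bounds `∑ cₖ` from below at once. As `cₖ` and `log (n - k + 1)` both decrease
in `k`, Chebyshev's sum inequality turns the first into the matching bound from above, so
`∑_{k≤n} cₖ = n / log n + O(n / log² n)` without any Tauberian theorem.
-/

/-- For `0 < u < 1`, the value at `u` is `λ {x ∈ [0,1] : Fⁿ x ≥ u}` (see
`volume_real_fareyLevelSet`), given by the recursion that comes from `F y ≥ u ↔ u / (1 + u) ≤ y ≤ 1 / (1 + u)`. -/
noncomputable def fareyTail : ℕ → ℝ → ℝ
  | 0, x => 1 - x
  | n + 1, x => fareyTail n (x / (1 + x)) - fareyTail n (1 / (1 + x))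

/-- The density of the law of `Fⁿ` under Lebesgue measure, relative to the infinite `F`-invariant
measure `dx / x`: the iterates of `φ₀(x) = x` under the transfer operator of the Farey map. -/
noncomputable def fareyDensity : ℕ → ℝ → ℝ
  | 0, x => x
  | n + 1, x => (fareyDensity n (x / (1 + x)) + x * fareyDensity n (1 / (1 + x))) / (1 + x)

/-! ### The Lebesgue measure of the level sets -/

theorem measurable_fareyMap : Measurable fareyMap := by
  unfold fareyMap
  exact Measurable.ite measurableSet_Iic (by fun_prop) (by fun_prop)

theorem le_fareyMap_iff {u y : ℝ} (hu : 0 < u) (hu1 : u < 1) (hy : y ∈ Set.Icc (0 : ℝ) 1) :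
    u ≤ fareyMap y ↔ u / (1 + u) ≤ y ∧ y ≤ 1 / (1 + u) := by
  have h1u : 0 < 1 + u := by linarith
  obtain ⟨h0, h1⟩ := hy
  unfold fareyMap
  rw [div_le_iff₀ h1u, le_div_iff₀ h1u]
  split_ifs with h
  · rw [le_div_iff₀ (by linarith)]
    exact ⟨fun h' => ⟨by linarith, by nlinarith⟩, fun h' => by linarith [h'.1]⟩
  · rw [le_div_iff₀ (by linarith)]
    exact ⟨fun h' => ⟨by nlinarith, by linarith⟩, fun h' => by linarith [h'.2]⟩

theorem lt_fareyMap_iff {u y : ℝ} (hu : 0 < u) (hu1 : u < 1) (hy : y ∈ Set.Icc (0 : ℝ) 1) :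
    u < fareyMap y ↔ u / (1 + u) < y ∧ y < 1 / (1 + u) := by
  have h1u : 0 < 1 + u := by linarith
  obtain ⟨h0, h1⟩ := hy
  unfold fareyMap
  rw [div_lt_iff₀ h1u, lt_div_iff₀ h1u]
  split_ifs with h
  · rw [lt_div_iff₀ (by linarith)]
    exact ⟨fun h' => ⟨by linarith, by nlinarith⟩, fun h' => by linarith [h'.1]⟩
  · rw [lt_div_iff₀ (by linarith)]
    exact ⟨fun h' => ⟨by nlinarith, by linarith⟩, fun h' => by linarith [h'.2]⟩

/-- Closed and open tails have to be carried along together, because preimages of one kind are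
differences involving the other; this also spares an argument that level sets of points are null. -/
theorem volume_real_le_iterate_fareyMap (n : ℕ) : ∀ u : ℝ, 0 < u → u < 1 →
    MeasureTheory.volume.real {x | x ∈ Set.Icc (0 : ℝ) 1 ∧ u ≤ fareyMap^[n] x} = fareyTail n u ∧
    MeasureTheory.volume.real {x | x ∈ Set.Icc (0 : ℝ) 1 ∧ u < fareyMap^[n] x} =
      fareyTail n u := by
  induction n with
  | zero =>
    intro u hu hu1
    constructor
    · have : {x | x ∈ Set.Icc (0 : ℝ) 1 ∧ u ≤ fareyMap^[0] x} = Set.Icc u 1 := by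
        ext x
        simp only [Function.iterate_zero, id, Set.mem_ofPred_eq, Set.mem_Icc]
        exact ⟨fun h => ⟨h.2, h.1.2⟩, fun h => ⟨⟨by linarith [h.1], h.2⟩, h.1⟩⟩
      rw [this, Real.volume_real_Icc_of_le hu1.le]
      rfl
    · have : {x | x ∈ Set.Icc (0 : ℝ) 1 ∧ u < fareyMap^[0] x} = Set.Ioc u 1 := by
        ext x
        simp only [Function.iterate_zero, id, Set.mem_ofPred_eq, Set.mem_Icc, Set.mem_Ioc]
        exact ⟨fun h => ⟨h.2, h.1.2⟩, fun h => ⟨⟨by linarith [h.1], h.2⟩, h.1⟩⟩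
      rw [this, Real.volume_real_Ioc_of_le hu1.le]
      rfl
  | succ n ih =>
    intro u hu hu1
    have h1u : 0 < 1 + u := by linarith
    have ha : 0 < u / (1 + u) := by positivity
    have hb : 0 < 1 / (1 + u) := by positivity
    have hab : u / (1 + u) < 1 / (1 + u) := by gcongr
    have hb1 : 1 / (1 + u) < 1 := by rw [div_lt_one h1u]; linarith
    obtain ⟨iha, iha'⟩ := ih _ ha (hab.trans hb1)
    obtain ⟨ihb, ihb'⟩ := ih _ hb hb1
    have hF : Measurable fareyMap^[n] := measurable_fareyMap.iterate n
    have hfin : ∀ p : ℝ → Prop,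
        MeasureTheory.volume {x | x ∈ Set.Icc (0 : ℝ) 1 ∧ p x} ≠ ⊤ := fun p =>
      ((MeasureTheory.measure_mono fun _ hx => hx.1).trans_lt measure_Icc_lt_top).ne
    constructor
    · have : {x | x ∈ Set.Icc (0 : ℝ) 1 ∧ u ≤ fareyMap^[n + 1] x} =
          {x | x ∈ Set.Icc (0 : ℝ) 1 ∧ u / (1 + u) ≤ fareyMap^[n] x} \
            {x | x ∈ Set.Icc (0 : ℝ) 1 ∧ 1 / (1 + u) < fareyMap^[n] x} := by
        ext x
        simp only [Set.mem_ofPred_eq, Set.mem_sdiff, not_and, not_lt, Function.iterate_succ_apply']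
        constructor
        · rintro ⟨hx, h⟩
          rw [le_fareyMap_iff hu hu1 (fareyMap_mapsTo.iterate n hx)] at h
          exact ⟨⟨hx, h.1⟩, fun _ => h.2⟩
        · rintro ⟨⟨hx, h⟩, h'⟩
          exact ⟨hx, (le_fareyMap_iff hu hu1 (fareyMap_mapsTo.iterate n hx)).2 ⟨h, h' hx⟩⟩
      rw [this, MeasureTheory.measureReal_sdiff _ _ (hfin _), iha, ihb']
      · rfl
      · exact fun x hx => ⟨hx.1, hab.le.trans hx.2.le⟩
      · exact measurableSet_Icc.inter (measurableSet_lt measurable_const hF)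
    · have : {x | x ∈ Set.Icc (0 : ℝ) 1 ∧ u < fareyMap^[n + 1] x} =
          {x | x ∈ Set.Icc (0 : ℝ) 1 ∧ u / (1 + u) < fareyMap^[n] x} \
            {x | x ∈ Set.Icc (0 : ℝ) 1 ∧ 1 / (1 + u) ≤ fareyMap^[n] x} := by
        ext x
        simp only [Set.mem_ofPred_eq, Set.mem_sdiff, not_and, not_le, Function.iterate_succ_apply']
        constructor
        · rintro ⟨hx, h⟩
          rw [lt_fareyMap_iff hu hu1 (fareyMap_mapsTo.iterate n hx)] at h
          exact ⟨⟨hx, h.1⟩, fun _ => h.2⟩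
        · rintro ⟨⟨hx, h⟩, h'⟩
          exact ⟨hx, (lt_fareyMap_iff hu hu1 (fareyMap_mapsTo.iterate n hx)).2 ⟨h, h' hx⟩⟩
      rw [this, MeasureTheory.measureReal_sdiff _ _ (hfin _), iha', ihb]
      · rfl
      · exact fun x hx => ⟨hx.1, hab.trans_le hx.2⟩
      · exact measurableSet_Icc.inter (measurableSet_le measurable_const hF)

theorem volume_real_fareyLevelSet {u : ℝ} (hu : u ∈ Set.Ioo (0 : ℝ) 1) (n : ℕ) :
    MeasureTheory.volume.real (fareyLevelSet u (n + 1)) = fareyTail n u := by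
  rw [← (volume_real_le_iterate_fareyMap n u hu.1 hu.2).1]
  congr 1
  ext x
  simp only [fareyLevelSet, Set.mem_ofPred_eq, Nat.add_sub_cancel]
  exact ⟨fun h => ⟨h.1, h.2.1⟩, fun h => ⟨h.1, h.2, (fareyMap_mapsTo.iterate n h.1).2⟩⟩

/-! ### Monotonicity and concavity of the densities -/

theorem fareyDensity_zero_right (n : ℕ) : fareyDensity n 0 = 0 := by
  induction n with
  | zero => rfl
  | succ n ih => simp [fareyDensity, ih]

theorem fareyDensity_succ_one (n : ℕ) : fareyDensity (n + 1) 1 = fareyDensity n (1 / 2) := by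
  norm_num [fareyDensity]

/-- In the coordinate `t = x / (1 + x)` the transfer operator becomes a symmetrization about
`t = 1 / 2`. -/
theorem fareyDensity_succ_eq (n : ℕ) {x : ℝ} (hx : 0 ≤ x) :
    fareyDensity (n + 1) x = (1 - x / (1 + x)) * fareyDensity n (x / (1 + x)) +
      x / (1 + x) * fareyDensity n (1 - x / (1 + x)) := by
  have h : 1 + x ≠ 0 := by linarith
  have h' : 1 - x / (1 + x) = 1 / (1 + x) := by field_simp; ring
  rw [h', fareyDensity]
  ring

theorem StrictMonoOn.symmetrize {f : ℝ → ℝ} (hf : StrictMonoOn f (Set.Icc 0 1))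
    (hc : ConcaveOn ℝ (Set.Icc 0 1) f) :
    StrictMonoOn (fun t => (1 - t) * f t + t * f (1 - t)) (Set.Icc 0 (1 / 2)) := by
  rintro t ⟨ht0, ht⟩ s ⟨hs0, hs⟩ hts
  have hd : 0 < 1 - 2 * t := by linarith
  have mt : t ∈ Set.Icc (0 : ℝ) 1 := ⟨ht0, by linarith⟩
  have mt' : 1 - t ∈ Set.Icc (0 : ℝ) 1 := ⟨by linarith, by linarith⟩
  have hlt : f t < f (1 - t) := hf mt mt' (by linarith)
  -- `s` and `1 - s` lie between `t` and `1 - t` and have the same sum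
  have key : f t + f (1 - t) ≤ f s + f (1 - s) := by
    obtain ⟨p, hp⟩ : ∃ p, p * (1 - 2 * t) = s - t := 
      ⟨(s - t) / (1 - 2 * t), div_mul_cancel₀ _ hd.ne'⟩
    have hp0 : 0 ≤ p := nonneg_of_mul_nonneg_left (by linarith : 0 ≤ p * (1 - 2 * t)) hd
    have hp1 : 0 ≤ 1 - p :=
      nonneg_of_mul_nonneg_left (by linarith : 0 ≤ (1 - p) * (1 - 2 * t)) hd
    have h1 := hc.2 mt mt' hp1 hp0 (by ring)
    have h2 := hc.2 mt mt' hp0 hp1 (by ring)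
    have e1 : (1 - p) * t + p * (1 - t) = s := by linear_combination hp
    have e2 : p * t + (1 - p) * (1 - t) = 1 - s := by linear_combination -hp
    simp only [smul_eq_mul, e1, e2] at h1 h2
    linarith
  have hst : f t ≤ f s := (hf mt ⟨hs0, by linarith⟩ hts).le
  show (1 - t) * f t + t * f (1 - t) < (1 - s) * f s + s * f (1 - s)
  nlinarith [mul_pos (sub_pos.2 hts) (sub_pos.2 hlt),
    mul_nonneg hs0 (sub_nonneg.2 key), mul_nonneg (by linarith : 0 ≤ 1 - 2 * s) (sub_nonneg.2 hst)]

theorem ConcaveOn.symmetrize {f : ℝ → ℝ} (hf : MonotoneOn f (Set.Icc 0 1))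
    (hc : ConcaveOn ℝ (Set.Icc 0 1) f) (h0 : 0 ≤ f 0) :
    ConcaveOn ℝ (Set.Icc 0 1) (fun t => (1 - t) * f t + t * f (1 - t)) := by
  have hpos : ∀ ⦃x⦄, x ∈ Set.Icc (0 : ℝ) 1 → 0 ≤ f x := fun x hx =>
    h0.trans (hf ⟨le_rfl, zero_le_one⟩ hx hx.1)
  have hrefl : ∀ ⦃x⦄, x ∈ Set.Icc (0 : ℝ) 1 → 1 - x ∈ Set.Icc (0 : ℝ) 1 := fun x hx =>
    ⟨by linarith [hx.2], by linarith [hx.1]⟩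
  have hid : ConcaveOn ℝ (Set.Icc (0 : ℝ) 1) (fun x : ℝ => x) := concaveOn_id (convex_Icc 0 1)
  have hsub : ConcaveOn ℝ (Set.Icc (0 : ℝ) 1) (fun x : ℝ => 1 - x) :=
    (concaveOn_const 1 (convex_Icc 0 1)).sub (convexOn_id (convex_Icc 0 1))
  have hfr : ConcaveOn ℝ (Set.Icc (0 : ℝ) 1) (fun x => f (1 - x)) := by
    refine ⟨convex_Icc 0 1, fun x hx y hy a b ha hb hab => ?_⟩
    have := hc.2 (hrefl hx) (hrefl hy) ha hb hab
    have e : 1 - (a • x + b • y) = a • (1 - x) + b • (1 - y) := by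
      simp only [smul_eq_mul]; linear_combination -hab
    simpa only [e] using this
  refine (hsub.mul hc (fun x hx => (hrefl hx).1) hpos ?_).add
    (hid.mul hfr (fun x hx => hx.1) (fun x hx => hpos (hrefl hx)) ?_)
  · intro x hx y hy hxy
    have : x < y := by
      by_contra h
      exact absurd (hf hy hx (not_lt.1 h)) (not_le.2 hxy)
    show 1 - y ≤ 1 - x
    linarith
  · intro x hx y hy hxy
    have : 1 - x < 1 - y := by
      by_contra h
      exact absurd (hf (hrefl hy) (hrefl hx) (not_lt.1 h)) (not_le.2 hxy)
    show y ≤ x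
    linarith

theorem strictMonoOn_div_one_add :
    StrictMonoOn (fun x : ℝ => x / (1 + x)) (Set.Icc 0 1) := by
  intro x hx y hy hxy
  show x / (1 + x) < y / (1 + y)
  rw [div_lt_div_iff₀ (by linarith [hx.1]) (by linarith [hy.1])]
  linarith

theorem concaveOn_div_one_add : ConcaveOn ℝ (Set.Icc 0 1) (fun x : ℝ => x / (1 + x)) := by
  refine ⟨convex_Icc 0 1, fun x hx y hy a b ha hb hab => ?_⟩
  obtain ⟨hx, -⟩ := hx
  obtain ⟨hy, -⟩ := hy
  obtain rfl : b = 1 - a := by linarith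
  have hx' : 0 < 1 + x := by linarith
  have hy' : 0 < 1 + y := by linarith
  have hz : 0 < 1 + (a * x + (1 - a) * y) := by positivity
  simp only [smul_eq_mul]
  have : (a * x + (1 - a) * y) / (1 + (a * x + (1 - a) * y)) -
      (a * (x / (1 + x)) + (1 - a) * (y / (1 + y))) =
      a * (1 - a) * (x - y) ^ 2 / ((1 + x) * (1 + y) * (1 + (a * x + (1 - a) * y))) := by
    field_simp
    ring
  have : 0 ≤ a * (1 - a) * (x - y) ^ 2 / ((1 + x) * (1 + y) * (1 + (a * x + (1 - a) * y))) := by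
    positivity
  linarith

theorem div_one_add_mem_Icc {x : ℝ} (hx : x ∈ Set.Icc (0 : ℝ) 1) :
    x / (1 + x) ∈ Set.Icc (0 : ℝ) (1 / 2) := by
  have h : 0 < 1 + x := by linarith [hx.1]
  exact ⟨div_nonneg hx.1 h.le, by rw [div_le_div_iff₀ h two_pos]; linarith [hx.2]⟩

/-- Strictly increasing concave functions are preserved by the transfer operator: the
symmetrization keeps concavity, and a concave function symmetric about `1 / 2` increases on
`[0, 1 / 2]`. Monotonicity alone would not be preserved. -/
theorem fareyDensity_strictMonoOn_concaveOn (n : ℕ) :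
    StrictMonoOn (fareyDensity n) (Set.Icc 0 1) ∧
      ConcaveOn ℝ (Set.Icc 0 1) (fareyDensity n) := by
  induction n with
  | zero => exact ⟨fun x _ y _ h => h, concaveOn_id (convex_Icc 0 1)⟩
  | succ n ih =>
    obtain ⟨hm, hc⟩ := ih
    have hs := hm.symmetrize hc
    have hsc : ConcaveOn ℝ (Set.Icc (0 : ℝ) (1 / 2)) _ :=
      (hc.symmetrize hm.monotoneOn (fareyDensity_zero_right n).ge).subset
        (Set.Icc_subset_Icc le_rfl (by norm_num)) (convex_Icc _ _)
    constructor
    · intro x hx y hy hxy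
      rw [fareyDensity_succ_eq n hx.1, fareyDensity_succ_eq n hy.1]
      exact hs (div_one_add_mem_Icc hx) (div_one_add_mem_Icc hy)
        (strictMonoOn_div_one_add hx hy hxy)
    · refine ⟨convex_Icc 0 1, fun x hx y hy a b ha hb hab => ?_⟩
      have hz := convex_Icc (0 : ℝ) 1 hx hy ha hb hab
      rw [fareyDensity_succ_eq n hx.1, fareyDensity_succ_eq n hy.1, fareyDensity_succ_eq n hz.1]
      have hx' := div_one_add_mem_Icc hx
      have hy' := div_one_add_mem_Icc hy
      exact (hsc.2 hx' hy' ha hb hab).trans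
        (hs.monotoneOn (convex_Icc _ _ hx' hy' ha hb hab) (div_one_add_mem_Icc hz)
          (concaveOn_div_one_add.2 hx hy ha hb hab))

theorem fareyDensity_strictMonoOn (n : ℕ) : StrictMonoOn (fareyDensity n) (Set.Icc 0 1) :=
  (fareyDensity_strictMonoOn_concaveOn n).1

theorem fareyDensity_nonneg (n : ℕ) {x : ℝ} (hx : x ∈ Set.Icc (0 : ℝ) 1) :
    0 ≤ fareyDensity n x :=
  (fareyDensity_zero_right n).ge.trans
    ((fareyDensity_strictMonoOn n).monotoneOn ⟨le_rfl, zero_le_one⟩ hx hx.1)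

/-! ### Tails as integrals of the densities -/

theorem hasDerivAt_fareyTail (n : ℕ) :
    ∀ x : ℝ, 0 < x → HasDerivAt (fareyTail n) (-(fareyDensity n x / x)) x := by
  induction n with
  | zero =>
    intro x hx
    have h0 : fareyTail 0 = fun y => 1 - y := rfl
    rw [h0, fareyDensity, div_self hx.ne']
    exact (hasDerivAt_id x).const_sub 1
  | succ n ih =>
    intro x hx
    have h : 0 < 1 + x := by linarith
    have hadd : HasDerivAt (fun y : ℝ => 1 + y) 1 x := (hasDerivAt_id x).const_add 1
    have h0 := (ih (x / (1 + x)) (by positivity)).comp x ((hasDerivAt_id x).div hadd h.ne')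
    have h1 := (ih (1 / (1 + x)) (by positivity)).comp x
      ((hasDerivAt_const x (1 : ℝ)).div hadd h.ne')
    refine (h0.sub h1).congr_deriv ?_
    simp only [fareyDensity, id_eq]
    field_simp
    ring

theorem fareyTail_one (n : ℕ) : fareyTail n 1 = 0 := by
  cases n <;> simp [fareyTail]

theorem strictAntiOn_fareyTail_add_const_mul_log (n : ℕ) {a b : ℝ} (ha : 0 < a) (hb : b ≤ 1) :
    StrictAntiOn (fun x => fareyTail n x + fareyDensity n a * Real.log x) (Set.Icc a b) := by
  have hd : ∀ x, 0 < x → HasDerivAt (fun x => fareyTail n x + fareyDensity n a * Real.log x)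
      (-(fareyDensity n x / x) + fareyDensity n a * x⁻¹) x := fun x hx =>
    (hasDerivAt_fareyTail n x hx).add ((Real.hasDerivAt_log hx.ne').const_mul _)
  refine strictAntiOn_of_deriv_neg (convex_Icc a b)
    (fun x hx => (hd x (ha.trans_le hx.1)).continuousAt.continuousWithinAt) fun x hx => ?_
  rw [interior_Icc] at hx
  have hx0 : 0 < x := ha.trans hx.1
  rw [(hd x hx0).deriv, div_eq_mul_inv]
  have := fareyDensity_strictMonoOn n ⟨ha.le, by linarith [hx.1, hx.2]⟩
    ⟨hx0.le, by linarith [hx.2]⟩ hx.1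
  nlinarith [inv_pos.2 hx0]

theorem strictMonoOn_fareyTail_add_const_mul_log (n : ℕ) {a b : ℝ} (ha : 0 < a) (hb : b ≤ 1) :
    StrictMonoOn (fun x => fareyTail n x + fareyDensity n b * Real.log x) (Set.Icc a b) := by
  have hd : ∀ x, 0 < x → HasDerivAt (fun x => fareyTail n x + fareyDensity n b * Real.log x)
      (-(fareyDensity n x / x) + fareyDensity n b * x⁻¹) x := fun x hx =>
    (hasDerivAt_fareyTail n x hx).add ((Real.hasDerivAt_log hx.ne').const_mul _)
  refine strictMonoOn_of_deriv_pos (convex_Icc a b)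
    (fun x hx => (hd x (ha.trans_le hx.1)).continuousAt.continuousWithinAt) fun x hx => ?_
  rw [interior_Icc] at hx
  have hx0 : 0 < x := ha.trans hx.1
  rw [(hd x hx0).deriv, div_eq_mul_inv]
  have := fareyDensity_strictMonoOn n ⟨hx0.le, by linarith [hx.2]⟩
    ⟨by linarith [hx.1, hx.2], hb⟩ hx.2
  nlinarith [inv_pos.2 hx0]

theorem lt_fareyTail_sub (n : ℕ) {a b : ℝ} (ha : 0 < a) (hab : a < b) (hb : b ≤ 1) :
    fareyDensity n a * Real.log (b / a) < fareyTail n a - fareyTail n b := by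
  have := strictAntiOn_fareyTail_add_const_mul_log n ha hb ⟨le_rfl, hab.le⟩ ⟨hab.le, le_rfl⟩ hab
  rw [Real.log_div (ha.trans hab).ne' ha.ne']
  dsimp only at this
  linarith

theorem fareyTail_sub_lt (n : ℕ) {a b : ℝ} (ha : 0 < a) (hab : a < b) (hb : b ≤ 1) :
    fareyTail n a - fareyTail n b < fareyDensity n b * Real.log (b / a) := by
  have := strictMonoOn_fareyTail_add_const_mul_log n ha hb ⟨le_rfl, hab.le⟩ ⟨hab.le, le_rfl⟩ hab
  rw [Real.log_div (ha.trans hab).ne' ha.ne']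
  dsimp only at this
  linarith

theorem fareyTail_nonneg (n : ℕ) {u : ℝ} (hu : u ∈ Set.Ioo (0 : ℝ) 1) : 0 ≤ fareyTail n u := by
  rw [← volume_real_fareyLevelSet hu]
  exact MeasureTheory.measureReal_nonneg

/-! ### Monotonicity in time -/

/-- The drop of the tail in one step compares the masses of `[1 / (1 + u), 1]` and
`[u / (1 + u), u]`, which have the same measure `log (1 + u)` for `dx / x`; the first interval lies
to the right of the second, and the density increases. -/
theorem fareyTail_succ_lt (n : ℕ) {u : ℝ} (hu : u ∈ Set.Ioo (0 : ℝ) 1) :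
    fareyTail (n + 1) u < fareyTail n u := by
  obtain ⟨hu0, hu1⟩ := hu
  have h : 0 < 1 + u := by linarith
  have ha : 0 < u / (1 + u) := by positivity
  have hb : 0 < 1 / (1 + u) := by positivity
  have hau : u / (1 + u) < u := div_lt_self hu0 (by linarith)
  have hb1 : 1 / (1 + u) < 1 := by rw [div_lt_one h]; linarith
  have hm := (fareyDensity_strictMonoOn n).monotoneOn
  simp only [fareyTail]
  rcases le_total u (1 / (1 + u)) with hle | hle
  · have h1 := lt_fareyTail_sub n hb hb1 le_rfl
    have h2 := fareyTail_sub_lt n ha hau hu1.le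
    rw [fareyTail_one] at h1
    have e1 : (1 : ℝ) / (1 / (1 + u)) = 1 + u := by field_simp
    have e2 : u / (u / (1 + u)) = 1 + u := by field_simp
    rw [e1] at h1
    rw [e2] at h2
    have := mul_le_mul_of_nonneg_right (hm ⟨hu0.le, hu1.le⟩ ⟨hb.le, hb1.le⟩ hle)
      (Real.log_pos (by linarith : 1 < 1 + u)).le
    linarith
  -- the two intervals overlap, and their common part `[1 / (1 + u), u]` cancels
  · have h1 := lt_fareyTail_sub n hu0 hu1 le_rfl
    have h2 := fareyTail_sub_lt n ha (by gcongr) hb1.le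
    rw [fareyTail_one] at h1
    have e2 : 1 / (1 + u) / (u / (1 + u)) = 1 / u := by field_simp
    rw [e2] at h2
    have := mul_le_mul_of_nonneg_right (hm ⟨hb.le, hb1.le⟩ ⟨hu0.le, hu1.le⟩ hle)
      (Real.log_pos (by rw [lt_div_iff₀ hu0]; linarith : 1 < 1 / u)).le
    linarith

theorem fareyDensity_half_sub_mul_log_le (n : ℕ) {u : ℝ} (hu : 0 < u) (hu2 : u ≤ 1 / 2) :
    (fareyDensity n (1 / 2) - fareyDensity n u) * Real.log (1 + u) ≤
      fareyTail n u - fareyTail (n + 1) u := by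
  have h : 0 < 1 + u := by linarith
  have ha : 0 < u / (1 + u) := by positivity
  have hb : 0 < 1 / (1 + u) := by positivity
  have hb1 : 1 / (1 + u) < 1 := by rw [div_lt_one h]; linarith
  have h1 := lt_fareyTail_sub n hb hb1 le_rfl
  have h2 := fareyTail_sub_lt n ha (div_lt_self hu (by linarith)) (by linarith : u ≤ 1)
  rw [fareyTail_one] at h1
  have e1 : (1 : ℝ) / (1 / (1 + u)) = 1 + u := by field_simp
  have e2 : u / (u / (1 + u)) = 1 + u := by field_simp
  rw [e1] at h1
  rw [e2] at h2
  have hle : (1 : ℝ) / 2 ≤ 1 / (1 + u) := by gcongr; linarith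
  have := mul_le_mul_of_nonneg_right ((fareyDensity_strictMonoOn n).monotoneOn
    ⟨by norm_num, by norm_num⟩ ⟨hb.le, hb1.le⟩ hle) (Real.log_pos (by linarith : 1 < 1 + u)).le
  simp only [fareyTail]
  linarith

/-- Both terms on the right telescope when summed over `n`. -/
theorem fareyDensity_one_sub_le (n : ℕ) {u : ℝ} (hu : u ∈ Set.Ioo (0 : ℝ) 1) :
    fareyDensity n 1 - fareyDensity n u ≤ (fareyDensity n 1 - fareyDensity (n + 1) 1) +
      (fareyTail n u - fareyTail (n + 1) u) / Real.log (1 + u) := by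
  have hlog : 0 < Real.log (1 + u) := Real.log_pos (by linarith [hu.1])
  rw [fareyDensity_succ_one]
  rcases le_total u (1 / 2) with h | h
  · have := (le_div_iff₀ hlog).2 (fareyDensity_half_sub_mul_log_le n hu.1 h)
    linarith
  · have h1 := (fareyDensity_strictMonoOn n).monotoneOn ⟨by norm_num, by norm_num⟩
      ⟨hu.1.le, hu.2.le⟩ h
    have h2 : 0 ≤ (fareyTail n u - fareyTail (n + 1) u) / Real.log (1 + u) :=
      div_nonneg (sub_nonneg.2 (fareyTail_succ_lt n hu).le) hlog.le
    linarith

theorem sum_fareyTail_le (n : ℕ) {u : ℝ} (hu : u ∈ Set.Ioo (0 : ℝ) 1) :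
    ∑ k ∈ Finset.range n, fareyTail k u ≤
      Real.log (1 / u) * ∑ k ∈ Finset.range n, fareyDensity k 1 := by
  rw [Finset.mul_sum]
  refine Finset.sum_le_sum fun k _ => ?_
  have := fareyTail_sub_lt k hu.1 hu.2 le_rfl
  rw [fareyTail_one] at this
  linarith

theorem le_sum_fareyTail (n : ℕ) {u : ℝ} (hu : u ∈ Set.Ioo (0 : ℝ) 1) :
    Real.log (1 / u) * (∑ k ∈ Finset.range n, fareyDensity k 1 - (1 + 1 / Real.log (1 + u))) ≤
      ∑ k ∈ Finset.range n, fareyTail k u := by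
  have hlog : 0 < Real.log (1 + u) := Real.log_pos (by linarith [hu.1])
  have hlu : 0 < Real.log (1 / u) := Real.log_pos (by rw [lt_div_iff₀ hu.1]; linarith [hu.2])
  have h1 : ∑ k ∈ Finset.range n, (fareyDensity k 1 - fareyDensity k u) ≤
      1 + 1 / Real.log (1 + u) := by
    refine (Finset.sum_le_sum fun k _ => fareyDensity_one_sub_le k hu).trans ?_
    rw [Finset.sum_add_distrib, ← Finset.sum_div, Finset.sum_range_sub', Finset.sum_range_sub']
    have h0 : fareyDensity 0 1 = 1 := rfl
    have h0' : fareyTail 0 u = 1 - u := rfl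
    rw [h0, h0']
    gcongr
    · linarith [fareyDensity_nonneg n (x := 1) ⟨zero_le_one, le_rfl⟩]
    · linarith [fareyTail_nonneg n hu, hu.1]
  rw [Finset.sum_sub_distrib] at h1
  have h2 : Real.log (1 / u) * ∑ k ∈ Finset.range n, fareyDensity k u ≤
      ∑ k ∈ Finset.range n, fareyTail k u := by
    rw [Finset.mul_sum]
    refine Finset.sum_le_sum fun k _ => ?_
    have := lt_fareyTail_sub k hu.1 hu.2 le_rfl
    rw [fareyTail_one] at this
    linarith
  refine le_trans (mul_le_mul_of_nonneg_left ?_ hlu.le) h2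
  linarith

/-! ### The renewal equation -/

theorem fareyTail_zero_inv_eq (n : ℕ) : ∀ j : ℕ,
    fareyTail 0 (1 / ((j : ℝ) + n + 1)) = fareyTail n (1 / ((j : ℝ) + 1)) +
      ∑ k ∈ Finset.range n, fareyTail k
        ((((n - 1 - k : ℕ) : ℝ) + j + 1) / (((n - 1 - k : ℕ) : ℝ) + j + 2)) := by
  induction n with
  | zero => intro j; simp
  | succ n ih =>
    intro j
    have h := ih (j + 1)
    have hj : (0 : ℝ) < (j : ℝ) + 1 := by positivity
    have hstep : fareyTail (n + 1) (1 / ((j : ℝ) + 1)) =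
        fareyTail n (1 / ((j : ℝ) + 2)) - fareyTail n (((j : ℝ) + 1) / ((j : ℝ) + 2)) := by
      have hj2 : (j : ℝ) + 1 + 1 = j + 2 := by ring
      have e1 : 1 / ((j : ℝ) + 1) / (1 + 1 / ((j : ℝ) + 1)) = 1 / (j + 2) := by
        rw [← hj2]; field_simp
      have e2 : 1 / (1 + 1 / ((j : ℝ) + 1)) = (j + 1) / (j + 2) := by
        rw [← hj2]; field_simp
      rw [fareyTail, e1, e2]
    rw [Finset.sum_range_succ, hstep]
    have hsum : ∑ k ∈ Finset.range n, fareyTail k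
        ((((n - 1 - k : ℕ) : ℝ) + ((j + 1 : ℕ) : ℝ) + 1) /
          (((n - 1 - k : ℕ) : ℝ) + ((j + 1 : ℕ) : ℝ) + 2)) =
        ∑ k ∈ Finset.range n, fareyTail k
        ((((n + 1 - 1 - k : ℕ) : ℝ) + j + 1) / (((n + 1 - 1 - k : ℕ) : ℝ) + j + 2)) := by
      refine Finset.sum_congr rfl fun k hk => ?_
      have hk := Finset.mem_range.1 hk
      have e : ((n + 1 - 1 - k : ℕ) : ℝ) = ((n - 1 - k : ℕ) : ℝ) + 1 := by
        have : n + 1 - 1 - k = (n - 1 - k) + 1 := by omega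
        rw [this]; push_cast; rfl
      rw [e]
      push_cast
      congr 2 <;> ring
    rw [hsum] at h
    have e0 : ((n + 1 - 1 - n : ℕ) : ℝ) = 0 := by simp
    rw [e0]
    push_cast at h ⊢
    have e1 : (j : ℝ) + (n + 1) + 1 = j + 1 + n + 1 := by ring
    have e2 : (j : ℝ) + 1 + 1 = j + 2 := by ring
    rw [e2] at h
    rw [e1, h]
    simp only [zero_add]
    ring

/-- The last visit to `[1/2, 1]` up to time `n` happens at some time `k ≤ n`, unless the orbit
starts in `[0, 1 / (n + 2)]`; and, up to null sets, `[(m + 1) / (m + 2), 1]` consists of the points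
of `[1/2, 1]` that do not return during the next `m` steps. -/
theorem sum_fareyTail_eq_one_sub (n : ℕ) :
    ∑ k ∈ Finset.range (n + 1), fareyTail k
      ((((n - k : ℕ) : ℝ) + 1) / (((n - k : ℕ) : ℝ) + 2)) = 1 - 1 / ((n : ℝ) + 2) := by
  have h := fareyTail_zero_inv_eq (n + 1) 0
  simp only [Nat.cast_zero, zero_add, add_zero, div_one, fareyTail_one, Nat.add_sub_cancel,
    Nat.cast_add, Nat.cast_one] at h
  rw [← h, fareyTail]
  congr 2
  ring

theorem fareyTail_div_le (n m : ℕ) :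
    fareyTail n (((m : ℝ) + 1) / (m + 2)) ≤
      fareyDensity n 1 * Real.log (((m : ℝ) + 2) / (m + 1)) := by
  have h := fareyTail_sub_lt n (a := ((m : ℝ) + 1) / (m + 2)) (by positivity)
    (by rw [div_lt_one (by positivity)]; linarith) le_rfl
  rw [fareyTail_one, one_div_div] at h
  linarith

theorem le_fareyTail_div (n m : ℕ) :
    fareyDensity (n + 1) 1 * Real.log (((m : ℝ) + 2) / (m + 1)) ≤
      fareyTail n (((m : ℝ) + 1) / (m + 2)) := by
  have hm : (0 : ℝ) ≤ m := m.cast_nonneg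
  have hm1 : ((m : ℝ) + 1) / (m + 2) < 1 := by rw [div_lt_one (by positivity)]; linarith
  have h := lt_fareyTail_sub n (a := ((m : ℝ) + 1) / (m + 2)) (by positivity) hm1 le_rfl
  rw [fareyTail_one, one_div_div, sub_zero] at h
  refine le_trans ?_ h.le
  rw [fareyDensity_succ_one]
  refine mul_le_mul_of_nonneg_right ?_ (Real.log_nonneg ?_)
  · refine (fareyDensity_strictMonoOn n).monotoneOn ⟨by norm_num, by norm_num⟩
      ⟨by positivity, hm1.le⟩ ?_
    rw [div_le_div_iff₀ (by norm_num) (by positivity)]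
    linarith
  · rw [one_le_div (by positivity)]; linarith

theorem sum_range_log_div (n : ℕ) :
    ∑ k ∈ Finset.range n, Real.log (((k : ℝ) + 2) / (k + 1)) = Real.log (n + 1) := by
  have h : ∀ k ∈ Finset.range n, Real.log (((k : ℝ) + 2) / (k + 1)) =
      Real.log (((k + 1 : ℕ) : ℝ) + 1) - Real.log ((k : ℝ) + 1) := fun k _ => by
    rw [Real.log_div (by positivity) (by positivity)]
    push_cast
    congr 2
    ring
  rw [Finset.sum_congr rfl h, Finset.sum_range_sub (fun k : ℕ => Real.log ((k : ℝ) + 1))]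
  simp

theorem sum_sum_mul_log_div (a : ℕ → ℝ) (n : ℕ) :
    ∑ m ∈ Finset.range n, ∑ k ∈ Finset.range (m + 1),
        a k * Real.log ((((m - k : ℕ) : ℝ) + 2) / (((m - k : ℕ) : ℝ) + 1)) =
      ∑ k ∈ Finset.range n, a k * Real.log (((n - k : ℕ) : ℝ) + 1) := by
  rw [Finset.sum_range_diag_flip n
    (fun k j => a k * Real.log (((j : ℝ) + 2) / ((j : ℝ) + 1)))]
  refine Finset.sum_congr rfl fun k _ => ?_
  rw [← Finset.mul_sum, sum_range_log_div]

theorem le_sum_fareyDensity_mul_log (n : ℕ) :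
    (n : ℝ) - Real.log (n + 1) ≤ (∑ k ∈ Finset.range n, fareyDensity k 1) * Real.log (n + 1) := by
  calc (n : ℝ) - Real.log (n + 1)
      ≤ ∑ m ∈ Finset.range n, (1 - 1 / ((m : ℝ) + 2)) := by
        rw [Finset.sum_sub_distrib, ← sum_range_log_div n]
        simp only [Finset.sum_const, Finset.card_range, nsmul_eq_mul, mul_one]
        refine sub_le_sub_left (Finset.sum_le_sum fun m _ => ?_) _
        refine le_trans (le_of_eq ?_) (Real.one_sub_inv_le_log_of_pos (by positivity))
        field_simp
        ring
    _ ≤ ∑ m ∈ Finset.range n, ∑ k ∈ Finset.range (m + 1), fareyDensity k 1 *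
          Real.log ((((m - k : ℕ) : ℝ) + 2) / (((m - k : ℕ) : ℝ) + 1)) := by
        refine Finset.sum_le_sum fun m _ => ?_
        rw [← sum_fareyTail_eq_one_sub]
        exact Finset.sum_le_sum fun k _ => fareyTail_div_le k (m - k)
    _ = ∑ k ∈ Finset.range n, fareyDensity k 1 * Real.log (((n - k : ℕ) : ℝ) + 1) :=
        sum_sum_mul_log_div _ n
    _ ≤ _ := by
        rw [Finset.sum_mul]
        refine Finset.sum_le_sum fun k _ => mul_le_mul_of_nonneg_left ?_
          (fareyDensity_nonneg k ⟨zero_le_one, le_rfl⟩)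
        have : ((n - k : ℕ) : ℝ) ≤ n := by exact_mod_cast Nat.sub_le n k
        gcongr

theorem sum_fareyDensity_succ_mul_log_le (n : ℕ) :
    ∑ k ∈ Finset.range n, fareyDensity (k + 1) 1 * Real.log (((n - k : ℕ) : ℝ) + 1) ≤ n := by
  rw [← sum_sum_mul_log_div (fun k => fareyDensity (k + 1) 1)]
  calc _ ≤ ∑ m ∈ Finset.range n, (1 : ℝ) := by
        refine Finset.sum_le_sum fun m _ => ?_
        refine (Finset.sum_le_sum fun k _ => le_fareyTail_div k (m - k)).trans ?_
        rw [sum_fareyTail_eq_one_sub]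
        have : (0 : ℝ) ≤ 1 / ((m : ℝ) + 2) := by positivity
        linarith
    _ = n := by simp

theorem antitone_fareyDensity_one : Antitone fun n => fareyDensity n 1 :=
  antitone_nat_of_succ_le fun n => by
    rw [fareyDensity_succ_one]
    exact (fareyDensity_strictMonoOn n).monotoneOn ⟨by norm_num, by norm_num⟩
      ⟨by norm_num, by norm_num⟩ (by norm_num)

theorem mul_log_sub_one_le_sum_log {n : ℕ} (hn : 0 < n) :
    (n : ℝ) * (Real.log n - 1) ≤ ∑ k ∈ Finset.range n, Real.log ((k : ℝ) + 1 + 1) := by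
  have h1 := Real.pow_div_factorial_le_exp (n : ℝ) n.cast_nonneg n
  have hn' : (0 : ℝ) < n := by exact_mod_cast hn
  have h2 := Real.log_le_log (by positivity) h1
  rw [Real.log_div (by positivity) (by positivity), Real.log_exp, Real.log_pow] at h2
  have h3 : Real.log (n.factorial : ℝ) = ∑ k ∈ Finset.range n, Real.log ((k : ℝ) + 1) := by
    rw [← Finset.prod_range_add_one_eq_factorial]
    push_cast
    exact Real.log_prod fun k _ => by positivity
  have h4 : ∑ k ∈ Finset.range n, Real.log ((k : ℝ) + 1) ≤
      ∑ k ∈ Finset.range n, Real.log ((k : ℝ) + 1 + 1) :=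
    Finset.sum_le_sum fun k _ => Real.log_le_log (by positivity) (by linarith)
  linarith

/-- Chebyshev's sum inequality applies to the summed renewal equation, since both factors
decrease in `k`. -/
theorem sum_fareyDensity_mul_log_sub_one_le {n : ℕ} (hn : 0 < n) (hl : 1 ≤ Real.log n) :
    (∑ k ∈ Finset.range n, fareyDensity k 1 - 1) * (Real.log n - 1) ≤ n := by
  have hn' : (0 : ℝ) < n := by exact_mod_cast hn
  have hmono : MonovaryOn (fun k => fareyDensity (k + 1) 1)
      (fun k : ℕ => Real.log (((n - k : ℕ) : ℝ) + 1)) (Finset.range n : Set ℕ) := by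
    refine AntitoneOn.monovaryOn (fun i _ j _ h => antitone_fareyDensity_one (by omega)) ?_
    intro i _ j _ h
    have : ((n - j : ℕ) : ℝ) ≤ ((n - i : ℕ) : ℝ) := by exact_mod_cast Nat.sub_le_sub_left h n
    dsimp only
    gcongr
  have h := hmono.sum_mul_sum_le_card_mul_sum
  have hrefl : ∑ k ∈ Finset.range n, Real.log (((n - k : ℕ) : ℝ) + 1) =
      ∑ k ∈ Finset.range n, Real.log ((k : ℝ) + 1 + 1) := by
    rw [← Finset.sum_range_reflect]
    refine Finset.sum_congr rfl fun k hk => ?_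
    have hk := Finset.mem_range.1 hk
    have : n - (n - 1 - k) = k + 1 := by omega
    rw [this]
    push_cast
    rfl
  rw [hrefl, Finset.card_range] at h
  have hs : ∑ k ∈ Finset.range n, fareyDensity k 1 - 1 ≤
      ∑ k ∈ Finset.range n, fareyDensity (k + 1) 1 := by
    have h1 := Finset.sum_range_succ' (fun k => fareyDensity k 1) n
    have h2 := Finset.sum_range_succ (fun k => fareyDensity k 1) n
    have h0 : fareyDensity 0 1 = 1 := rfl
    have := fareyDensity_nonneg n (x := 1) ⟨zero_le_one, le_rfl⟩
    linarith
  have hs0 : 0 ≤ ∑ k ∈ Finset.range n, fareyDensity (k + 1) 1 :=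
    Finset.sum_nonneg fun k _ => fareyDensity_nonneg _ ⟨zero_le_one, le_rfl⟩
  refine (mul_le_mul_of_nonneg_right hs (by linarith)).trans ?_
  refine le_of_mul_le_mul_left ?_ hn'
  calc (n : ℝ) * ((∑ k ∈ Finset.range n, fareyDensity (k + 1) 1) * (Real.log n - 1))
      = (∑ k ∈ Finset.range n, fareyDensity (k + 1) 1) * (n * (Real.log n - 1)) := by ring
    _ ≤ (∑ k ∈ Finset.range n, fareyDensity (k + 1) 1) *
          ∑ k ∈ Finset.range n, Real.log ((k : ℝ) + 1 + 1) :=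
        mul_le_mul_of_nonneg_left (mul_log_sub_one_le_sum_log hn) hs0
    _ ≤ n * n := h.trans
        (mul_le_mul_of_nonneg_left (sum_fareyDensity_succ_mul_log_le n) hn'.le)

/-! ### The asymptotics of the partial sums -/

theorem eventually_log_sq_le : ∀ᶠ n : ℕ in Filter.atTop, Real.log n ^ 2 ≤ n := by
  have := ((Real.isLittleO_pow_log_id_atTop (n := 2)).comp_tendsto
    (tendsto_natCast_atTop_atTop (R := ℝ))).bound one_pos
  filter_upwards [this] with n hn
  simpa using hn

theorem eventually_abs_sum_fareyDensity_sub_le :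
    ∀ᶠ n : ℕ in Filter.atTop,
      |∑ k ∈ Finset.range (n + 1), fareyDensity k 1 - n / Real.log n| ≤
        6 * (n / Real.log n ^ 2) := by
  have hlog : Filter.Tendsto (fun n : ℕ => Real.log n) Filter.atTop Filter.atTop :=
    Real.tendsto_log_atTop.comp tendsto_natCast_atTop_atTop
  filter_upwards [hlog.eventually_ge_atTop 2, eventually_log_sq_le,
    Filter.eventually_gt_atTop 0] with n hL hLn hn
  have hn' : (0 : ℝ) < n := by exact_mod_cast hn
  have lower := le_sum_fareyDensity_mul_log (n + 1)
  have hL1 : Real.log n ≤ Real.log ((n + 1 : ℕ) : ℝ) := by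
    refine Real.log_le_log hn' ?_
    push_cast
    linarith
  have upper := sum_fareyDensity_mul_log_sub_one_le n.succ_pos
    (by linarith : 1 ≤ Real.log ((n + 1 : ℕ) : ℝ))
  have hL2 : Real.log n ≤ Real.log (((n + 1 : ℕ) : ℝ) + 1) := by
    refine Real.log_le_log hn' ?_
    push_cast
    linarith
  have hL3 : Real.log (((n + 1 : ℕ) : ℝ) + 1) ≤ Real.log n + 2 / n := by
    have h := Real.log_le_sub_one_of_pos (by positivity : 0 < (((n + 1 : ℕ) : ℝ) + 1) / n)
    rw [Real.log_div (by positivity) hn'.ne'] at h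
    have e : (((n + 1 : ℕ) : ℝ) + 1) / n - 1 = 2 / n := by
      push_cast
      field_simp
      ring
    linarith
  set S := ∑ k ∈ Finset.range (n + 1), fareyDensity k 1
  have hS : 1 ≤ S := by
    have : fareyDensity 0 1 ≤ S := Finset.single_le_sum (f := fun k => fareyDensity k 1)
      (fun k _ => fareyDensity_nonneg k ⟨zero_le_one, le_rfl⟩) (by simp)
    exact this
  generalize Real.log (((n + 1 : ℕ) : ℝ) + 1) = L' at *
  generalize Real.log ((n + 1 : ℕ) : ℝ) = L₁ at *
  generalize Real.log (n : ℝ) = L at *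
  push_cast at lower upper
  have hL0 : 0 < L := by linarith
  have hL'0 : 0 < L' := by linarith
  have one_le : 1 ≤ n / L ^ 2 := by rwa [one_le_div (by positivity)]
  rw [abs_le]
  constructor
  · have h1 : n / L' - 1 ≤ S := by
      rw [sub_le_iff_le_add, div_le_iff₀ hL'0]
      linarith
    have h2 : n / L - n / L' ≤ 2 * (n / L ^ 2) := by
      have hn1 : (1 : ℝ) ≤ n := by exact_mod_cast hn
      calc n / L - n / L' = n * (L' - L) / (L * L') := by field_simp
        _ ≤ n * (2 / n) / (L * L) := by gcongr; linarith
        _ = 2 * (1 / L ^ 2) := by field_simp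
        _ ≤ 2 * (n / L ^ 2) := by gcongr
    linarith
  · have h1 : S - 1 ≤ (n + 1) / (L - 1) := by
      rw [le_div_iff₀ (by linarith)]
      refine le_trans (mul_le_mul_of_nonneg_left ?_ (by linarith)) upper
      linarith
    have h2 : (n + 1) / (L - 1) - n / L ≤ 4 * (n / L ^ 2) := by
      have hL1' : 0 < L - 1 := by linarith
      calc (n + 1) / (L - 1) - n / L = (L + n) / (L * (L - 1)) := by field_simp; ring
        _ ≤ (n + n) / (L * (L / 2)) := by
          gcongr
          · nlinarith
          · linarith
        _ = 4 * (n / L ^ 2) := by field_simp; ring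
    linarith

theorem theorem2 (u : ℝ) (hu : u ∈ Set.Ioo (0 : ℝ) 1) :
    StrictAntiOn (fun n : ℕ => MeasureTheory.volume.real (fareyLevelSet u n)) {n : ℕ | 1 ≤ n} ∧
    ∃ ε : ℕ → ℝ,
      Asymptotics.IsBigO Filter.atTop ε (fun n : ℕ => 1 / Real.log (n : ℝ)) ∧
      ∀ᶠ n : ℕ in Filter.atTop,
        ∑ k ∈ Finset.range (n + 1), MeasureTheory.volume.real (fareyLevelSet u (k + 1)) =
          (n : ℝ) * Real.log (1 / u) / Real.log (n : ℝ) * (1 + ε n) := by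
  constructor
  · have hanti : StrictAnti fun n => fareyTail n u :=
      strictAnti_nat_of_succ_lt fun n => fareyTail_succ_lt n hu
    rintro (_ | m) hm (_ | n) hn hmn
    · exact absurd hmn (lt_irrefl _)
    · exact absurd hm (by simp)
    · exact absurd hn (by simp)
    · simp only [volume_real_fareyLevelSet hu]
      exact hanti (by omega)
  · simp only [volume_real_fareyLevelSet hu]
    have hl : 0 < Real.log (1 / u) := Real.log_pos (by rw [lt_div_iff₀ hu.1]; linarith [hu.2])
    have hK : 0 < 1 / Real.log (1 + u) := one_div_pos.2 (Real.log_pos (by linarith [hu.1]))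
    have hlog : Filter.Tendsto (fun n : ℕ => Real.log n) Filter.atTop Filter.atTop :=
      Real.tendsto_log_atTop.comp tendsto_natCast_atTop_atTop
    refine ⟨fun n => (∑ k ∈ Finset.range (n + 1), fareyTail k u) * Real.log n /
      (n * Real.log (1 / u)) - 1, ?_, ?_⟩
    · refine Asymptotics.IsBigO.of_bound (7 + 1 / Real.log (1 + u)) ?_
      filter_upwards [eventually_abs_sum_fareyDensity_sub_le, hlog.eventually_gt_atTop 0,
        Filter.eventually_gt_atTop 0,
        eventually_log_sq_le] with n h hL hn hLn
      have hn' : (0 : ℝ) < n := by exact_mod_cast hn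
      have h1 := sum_fareyTail_le (n + 1) hu
      have h2 := le_sum_fareyTail (n + 1) hu
      have one_le : 1 ≤ n / Real.log n ^ 2 := by rwa [one_le_div (by positivity)]
      generalize ∑ k ∈ Finset.range (n + 1), fareyTail k u = T at *
      generalize ∑ k ∈ Finset.range (n + 1), fareyDensity k 1 = S at *
      generalize Real.log (1 / u) = l at *
      generalize 1 / Real.log (1 + u) = K at *
      generalize Real.log (n : ℝ) = L at *
      rw [abs_le] at h
      have hKn : 1 + K ≤ (1 + K) * (n / L ^ 2) := le_mul_of_one_le_right (by linarith) one_le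
      have key : |T / l - n / L| ≤ (7 + K) * (n / L ^ 2) := by
        have h1' : T / l ≤ S := by rw [div_le_iff₀ hl]; linarith
        have h2' : S - (1 + K) ≤ T / l := by rw [le_div_iff₀ hl]; linarith
        rw [abs_le]
        constructor <;> linarith
      have e : T * L / (n * l) - 1 = L / n * (T / l - n / L) := by field_simp
      rw [e, norm_mul, Real.norm_eq_abs, Real.norm_eq_abs, Real.norm_eq_abs,
        abs_of_pos (by positivity : 0 < L / n), abs_of_pos (by positivity : 0 < 1 / L)]
      calc L / n * |T / l - n / L| ≤ L / n * ((7 + K) * (n / L ^ 2)) := by gcongr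
        _ = (7 + K) * (1 / L) := by field_simp
    · filter_upwards [hlog.eventually_gt_atTop 0, Filter.eventually_gt_atTop 0] with n hL hn
      have hn' : (0 : ℝ) < n := by exact_mod_cast hn
      rw [add_sub_cancel]
      field_simp
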